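/- There is an absolute constant $c>0$ such that the following holds for all integers $n\ge 1$, $k\ge 0$, $T\ge 0$ and every accuracy $\varepsilon<1/2$. A learning algorithm with $k$ qubits of quantum memory that uses $T$ copies of an unknown $n$-qubit state $\rho$ is the following adaptive procedure. It starts with a fixed $k$-qubit density matrix $\Sigma_0$ as its memory. In each of $T$ rounds it receives a fresh copy of $\rho$ and measures the memory $\sigma$ together with this copy by a finite POVM $\{M_s^\dagger M_s\}_s$, $\sum_s M_s^\dagger M_s=\mathbb{1}$, $M_s\in\mathbb{C}^{2^{k+n+a}\times 2^{k+n}}$ (for some number $a\ge 0$ of appended qubits), where the POVM, the $M_s$ and $a$ may depend on all previous outcomes. Outcome $s$ occurs with probability $p_s=\mathrm{Tr}(M_s^\dagger M_s(\sigma\otimes\rho))$, and the memory then becomes the state $\mathrm{Tr}_{>k}\big(M_s(\sigma\otimes\rho)M_s^\dagger\big)/p_s$ of the first $k$ qubits. After $T$ rounds the algorithm outputs, as a function of the sequence of all outcomes, a real number $\hat f(P)$ for every $n$-qubit Pauli observable $P\in\{I,X,Y,Z\}^{\otimes n}$. If such an algorithm satisfies, for every $n$-qubit density matrix $\rho$,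 $$\Pr\Big[\,\big|\hat f(P)-|\mathrm{Tr}(P\rho)|\big|\le\varepsilon\ \text{ for all } P\in\{I,X,Y,Z\}^{\otimes n}\Big]\ \ge\ \tfrac23 ,$$ then $$T\ \ge\ c\cdot 2^{(n-k)/3}.$$ -/

import Mathlib

open scoped Matrix Kronecker ComplexOrder

namespace PauliMemory

noncomputable section

/-- Labels of the computational basis of `m` qubits. -/
abbrev Qubits (m : ℕ) : Type := Fin m → Fin 2

/-- A density matrix (mixed state). -/
def IsDensity {ι : Type} [Fintype ι] (ρ : Matrix ι ι ℂ) : Prop :=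
  ρ.PosSemidef ∧ ρ.trace = 1

/-- The four single-qubit Pauli labels. -/
inductive Pauli : Type
  | I
  | X
  | Y
  | Z

/-- The single-qubit Pauli matrices. -/
def Pauli.matrix : Pauli → Matrix (Fin 2) (Fin 2) ℂ
  | .I => !![1, 0; 0, 1]
  | .X => !![0, 1; 1, 0]
  | .Y => !![0, -Complex.I; Complex.I, 0]
  | .Z => !![1, 0; 0, -1]

/-- An `n`-qubit Pauli observable is given by one Pauli label for each qubit. -/
abbrev PauliString (n : ℕ) : Type := Fin n → Pauli

/-- The matrix of an `n`-qubit Pauli observable: the tensor product of its single-qubit factors. -/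
def PauliString.matrix {n : ℕ} (P : PauliString n) : Matrix (Qubits n) (Qubits n) ℂ :=
  Matrix.of fun i j => ∏ q, (P q).matrix (i q) (j q)

/-- The partial trace over the second tensor factor. -/
def partialTrace {ι κ : Type} [Fintype κ] (X : Matrix (ι × κ) (ι × κ) ℂ) : Matrix ι ι ℂ :=
  Matrix.of fun i j => ∑ x, X (i, x) (j, x)

/-- A POVM measurement on a `k`-qubit memory together with one fresh `n`-qubit copy. The POVM
elements are `(op s)ᴴ * op s`, and `op s` determines the post-measurement state; it may append
`ancilla` further qubits. The first `k` output qubits form the memory register. -/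
structure Measurement (n k : ℕ) : Type where
  ancilla : ℕ
  outcomes : ℕ
  op : Fin outcomes →
    Matrix (Qubits k × Qubits (n + ancilla)) (Qubits k × Qubits n) ℂ
  complete : ∑ s, (op s)ᴴ * op s = 1

/-- The unnormalized state of the memory after outcome `s`, if the memory was in the (unnormalized)
state `σ` and the fresh copy in the state `ρ`: the operator `op s` is applied to `σ ⊗ ρ`, and all
qubits but the first `k` are discarded. Its trace is the trace of `σ` times the probability
of `s`. -/
def Measurement.update {n k : ℕ} (E : Measurement n k) (ρ : Matrix (Qubits n) (Qubits n) ℂ)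
    (s : Fin E.outcomes) (σ : Matrix (Qubits k) (Qubits k) ℂ) : Matrix (Qubits k) (Qubits k) ℂ :=
  partialTrace (E.op s * (σ ⊗ₖ ρ) * (E.op s)ᴴ)

/-- The adaptive strategies that consume exactly `T` copies of an `n`-qubit state using `k` qubits
of memory, as rooted trees of depth `T`. A node stands for the transcript of the outcomes seen so
far. An inner node carries the measurement made there and one child for each outcome;
a leaf carries the prediction, a real number for every `n`-qubit Pauli observable. -/
inductive LearningTree (n k : ℕ) : ℕ → Type
  | leaf (prediction : PauliString n → ℝ) : LearningTree n k 0
  | node {T : ℕ} (E : Measurement n k) (child : Fin E.outcomes → LearningTree n k T) :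
      LearningTree n k (T + 1)

/-- The probability (scaled by the trace of the memory state `σ` at the root) that the prediction
made at the end lies in `S`: the sum of the traces of the unnormalized memory states over all leaves
whose prediction lies in `S`. -/
def LearningTree.prob {n k : ℕ} (ρ : Matrix (Qubits n) (Qubits n) ℂ)
    (S : Set (PauliString n → ℝ)) :
    {T : ℕ} → LearningTree n k T → Matrix (Qubits k) (Qubits k) ℂ → ℝ
  | _, .leaf prediction, σ => S.indicator (fun _ => σ.trace.re) prediction
  | _, .node E child, σ => ∑ s, (child s).prob ρ S (E.update ρ s σ)

/-- A learning algorithm with `k` qubits of quantum memory that uses `T` copies of an `n`-qubit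
state: an initial memory state together with an adaptive strategy. -/
structure LearningAlgorithm (n k T : ℕ) : Type where
  init : Matrix (Qubits k) (Qubits k) ℂ
  isDensity_init : IsDensity init
  tree : LearningTree n k T

/-- The probability that the prediction lies in `S` when the unknown state is `ρ`. -/
def LearningAlgorithm.prob {n k T : ℕ} (A : LearningAlgorithm n k T)
    (ρ : Matrix (Qubits n) (Qubits n) ℂ) (S : Set (PauliString n → ℝ)) : ℝ :=
  A.tree.prob ρ S A.init

/-- For every unknown state `ρ`, with probability at least `2/3`, the algorithm predicts
`|Tr(P ρ)|` up to error `ε` simultaneously for all `n`-qubit Pauli observables `P`. -/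
def LearningAlgorithm.PredictsAbsPauli {n k T : ℕ} (A : LearningAlgorithm n k T) (ε : ℝ) : Prop :=
  ∀ ρ : Matrix (Qubits n) (Qubits n) ℂ, IsDensity ρ →
    2 / 3 ≤ A.prob ρ {f | ∀ P : PauliString n, |f P - ‖(P.matrix * ρ).trace‖| ≤ ε}

end

end PauliMemory

namespace PauliMemory

/-! ### Pauli observables -/

/-! Accurate predictions tell the maximally mixed state apart from `2^{-n}(1 + P)` for every
nontrivial Pauli string `P`: the value at `P` is `0` for the first and `1` for the second, and `ε <
1/2`. So the acceptance probabilities differ by at least `1/3` (`third_le_abs_sub`).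

Conversely, a hybrid argument (`sum_abs_prob_sub_prob_le`) switches the copies one at a time. At one
outcome the switch changes the memory by a Hermitian matrix linear in `P`, and the rest of the tree
sees it only through its trace norm, at most `√(2^k)` times its Frobenius norm (`abs_prob_le`).
Parseval over all Pauli strings bounds the total squared Frobenius norm (`sum_norm_sq_update_le`).
By Cauchy–Schwarz one round contributes on average over `P` at most about `2^{(k-n)/2}`. Hence `T`
is at least of order `2^{(n-k)/2}`, which is stronger than the exponent `(n-k)/3` when `k ≤ n`. -/

instance : Fintype Pauli where
  elems := ⟨{.I, .X, .Y, .Z}, by simp⟩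
  complete := by intro p; cases p <;> simp

noncomputable instance : DecidableEq Pauli := Classical.decEq _

theorem Pauli.sum_univ {M : Type*} [AddCommMonoid M] (f : Pauli → M) :
    ∑ p, f p = f .I + (f .X + (f .Y + f .Z)) := by
  change (Multiset.map f {Pauli.I, Pauli.X, Pauli.Y, Pauli.Z}).sum = _
  simp

theorem Pauli.card : Fintype.card Pauli = 4 := rfl

theorem PauliString.card (n : ℕ) : Fintype.card (PauliString n) = 4 ^ n := by
  simp [PauliString, Pauli.card]

theorem Pauli.matrix_isHermitian (p : Pauli) : p.matrix.IsHermitian := by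
  ext i j
  cases p <;> fin_cases i <;> fin_cases j <;> simp [Pauli.matrix]

theorem Pauli.matrix_mul_self (p : Pauli) : p.matrix * p.matrix = 1 := by
  ext i j
  cases p <;> fin_cases i <;> fin_cases j <;> simp [Pauli.matrix, Matrix.mul_apply]

theorem Pauli.trace_matrix {p : Pauli} (hp : p ≠ .I) : p.matrix.trace = 0 := by
  cases p <;> simp_all [Pauli.matrix, Matrix.trace]

theorem Pauli.sum_mul_star (i j k l : Fin 2) :
    ∑ p : Pauli, p.matrix i j * star (p.matrix k l) = if i = k ∧ j = l then 2 else 0 := by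
  rw [Pauli.sum_univ]
  fin_cases i <;> fin_cases j <;> fin_cases k <;> fin_cases l <;> simp [Pauli.matrix] <;> norm_num

theorem PauliString.matrix_isHermitian {n : ℕ} (P : PauliString n) : P.matrix.IsHermitian := by
  ext i j
  simp only [PauliString.matrix, Matrix.conjTranspose_apply, Matrix.of_apply, star_prod]
  exact Finset.prod_congr rfl fun q _ => (P q).matrix_isHermitian.apply _ _

theorem PauliString.matrix_mul_self {n : ℕ} (P : PauliString n) : P.matrix * P.matrix = 1 := by
  ext i j
  simp only [PauliString.matrix, Matrix.mul_apply, Matrix.of_apply, ← Finset.prod_mul_distrib]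
  rw [← Fintype.prod_sum fun q x => (P q).matrix (i q) x * (P q).matrix x (j q)]
  have h (q : Fin n) : ∑ x, (P q).matrix (i q) x * (P q).matrix x (j q) =
      if i q = j q then 1 else 0 := by
    rw [← Matrix.mul_apply, Pauli.matrix_mul_self, Matrix.one_apply]
  simp only [h, Matrix.one_apply, funext_iff, Finset.prod_ite_zero, Finset.mem_univ, true_imp_iff,
    Finset.prod_const_one]

theorem PauliString.trace_matrix {n : ℕ} {P : PauliString n} (hP : P ≠ fun _ => .I) :
    P.matrix.trace = 0 := by
  obtain ⟨q, hq⟩ := Function.ne_iff.mp hP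
  simp only [PauliString.matrix, Matrix.trace, Matrix.diag_apply, Matrix.of_apply]
  rw [← Fintype.prod_sum fun q x => (P q).matrix x x]
  exact Finset.prod_eq_zero (Finset.mem_univ q) (Pauli.trace_matrix hq)

/-- Completeness of the Pauli basis; the sum over strings factors over qubits, each contributing `2`
or `0`. -/
theorem PauliString.sum_mul_star {n : ℕ} (i j k l : Qubits n) :
    ∑ P : PauliString n, P.matrix i j * star (P.matrix k l) =
      if i = k ∧ j = l then 2 ^ n else 0 := by
  simp only [PauliString.matrix, Matrix.of_apply, star_prod, ← Finset.prod_mul_distrib]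
  rw [← Fintype.prod_sum fun q p => Pauli.matrix p (i q) (j q) * star (Pauli.matrix p (k q) (l q))]
  simp only [Pauli.sum_mul_star, funext_iff, Finset.prod_ite_zero, Finset.mem_univ, true_imp_iff,
    Finset.prod_const, Finset.card_univ, Fintype.card_fin, ← forall_and]

/-- Parseval's identity: the Pauli observables are orthogonal, each of squared norm `2 ^ n`. -/
theorem PauliString.sum_norm_sq {n : ℕ} (X : Qubits n → Qubits n → ℂ) :
    ∑ P : PauliString n, ‖∑ i, ∑ j, X i j * P.matrix i j‖ ^ 2 =
      2 ^ n * ∑ i, ∑ j, ‖X i j‖ ^ 2 := by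
  have hn (z : ℂ) : ((‖z‖ ^ 2 : ℝ) : ℂ) = z * star z := by
    rw [Complex.star_def, Complex.mul_conj']; push_cast; rfl
  rw [← Complex.ofReal_inj]
  simp only [Complex.ofReal_sum, Complex.ofReal_mul, hn]
  simp only [← Fintype.sum_prod_type', star_sum, star_mul']
  simp only [Finset.sum_mul_sum]
  rw [Finset.sum_comm]
  have h (x : Qubits n × Qubits n) :
      ∑ P : PauliString n, ∑ y : Qubits n × Qubits n,
        X x.1 x.2 * P.matrix x.1 x.2 * (star (X y.1 y.2) * star (P.matrix y.1 y.2)) =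
      2 ^ n * (X x.1 x.2 * star (X x.1 x.2)) := by
    rw [Finset.sum_comm]
    have h' (y : Qubits n × Qubits n) : ∑ P : PauliString n,
        X x.1 x.2 * P.matrix x.1 x.2 * (star (X y.1 y.2) * star (P.matrix y.1 y.2)) =
        if x = y then 2 ^ n * (X x.1 x.2 * star (X y.1 y.2)) else 0 := by
      simp only [mul_mul_mul_comm (X x.1 x.2), ← Finset.mul_sum, PauliString.sum_mul_star,
        ← Prod.ext_iff]
      split_ifs <;> ring
    simp only [h', Finset.sum_ite_eq, Finset.mem_univ, if_true]
  rw [Finset.mul_sum, Complex.ofReal_pow, Complex.ofReal_ofNat]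
  exact Finset.sum_congr rfl fun x _ => h x

/-- The maximally mixed state, perturbed in the direction of a nontrivial Pauli observable, is a
density matrix. -/
theorem PauliString.isDensity_add {n : ℕ} {P : PauliString n} (hP : P ≠ fun _ => .I) :
    IsDensity (((2 : ℝ) ^ n)⁻¹ • (1 + P.matrix)) := by
  constructor
  · refine Matrix.PosSemidef.smul ?_ (by positivity)
    -- Since `P² = 1`, the matrix `1 + P` is twice a projection.
    have h : (1 + P.matrix) = (2⁻¹ : ℝ) • ((1 + P.matrix)ᴴ * (1 + P.matrix)) := by
      rw [Matrix.conjTranspose_add, Matrix.conjTranspose_one, P.matrix_isHermitian.eq, add_mul,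
        mul_add, mul_add, P.matrix_mul_self]
      simp only [one_mul, mul_one]
      module
    rw [h]
    exact (Matrix.posSemidef_conjTranspose_mul_self _).smul (by norm_num)
  · rw [Matrix.trace_smul, Matrix.trace_add, trace_matrix hP, Matrix.trace_one]
    simp [Qubits]

theorem isDensity_maximallyMixed (n : ℕ) :
    IsDensity (((2 : ℝ) ^ n)⁻¹ • (1 : Matrix (Qubits n) (Qubits n) ℂ)) := by
  constructor
  · exact Matrix.PosSemidef.one.smul (by positivity)
  · rw [Matrix.trace_smul, Matrix.trace_one]
    simp [Qubits]

/-! ### Matrix inequalities -/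

theorem trace_mul_self_of_isHermitian {ι : Type*} [Fintype ι] {X : Matrix ι ι ℂ}
    (hX : X.IsHermitian) : (X * X).trace = ((∑ a, ∑ b, ‖X a b‖ ^ 2 : ℝ) : ℂ) := by
  simp only [Matrix.trace, Matrix.diag_apply, Matrix.mul_apply, Complex.ofReal_sum]
  refine Finset.sum_congr rfl fun a _ => Finset.sum_congr rfl fun b _ => ?_
  rw [← hX.apply b a, Complex.star_def, Complex.mul_conj']
  push_cast; rfl

/-- A real functional that lies between zero and the trace on positive matrices is bounded by the
trace norm, hence by `√(dim)` times the Frobenius norm. -/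
theorem abs_le_sqrt_card_mul_frobenius {ι : Type*} [Fintype ι] [DecidableEq ι]
    (V : Matrix ι ι ℂ →ₗ[ℝ] ℝ) (h0 : ∀ X : Matrix ι ι ℂ, X.PosSemidef → 0 ≤ V X)
    (h1 : ∀ X : Matrix ι ι ℂ, X.PosSemidef → V X ≤ X.trace.re)
    {X : Matrix ι ι ℂ} (hX : X.IsHermitian) :
    |V X| ≤ √(Fintype.card ι) * √(∑ a, ∑ b, ‖X a b‖ ^ 2) := by
  set U : Matrix ι ι ℂ := (hX.eigenvectorUnitary).1 with hU
  have hUU : Uᴴ * U = 1 := Unitary.coe_star_mul_self hX.eigenvectorUnitary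
  have hs : X = U * Matrix.diagonal (fun i => (hX.eigenvalues i : ℂ)) * Uᴴ := by
    conv_lhs => rw [hX.spectral_theorem, Unitary.conjStarAlgAut_apply]
    rfl
  have hsum : X = ∑ i, hX.eigenvalues i • Matrix.vecMulVec (U.col i) (star (U.col i)) := by
    conv_lhs => rw [hs]
    ext a b
    simp [Matrix.sum_apply, Matrix.mul_apply, Matrix.vecMulVec_apply, Matrix.diagonal_apply]
    exact Finset.sum_congr rfl fun i _ => by ring
  have htr (i : ι) : (Matrix.vecMulVec (U.col i) (star (U.col i))).trace.re = 1 := by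
    have h := congrFun (congrFun hUU i) i
    rw [Matrix.one_apply_eq, Matrix.mul_apply] at h
    rw [Matrix.trace, ← Complex.one_re, ← h]
    congr 1
    exact Finset.sum_congr rfl fun a _ => by simp [Matrix.vecMulVec_apply, mul_comm]
  have hfrob : ∑ i, hX.eigenvalues i ^ 2 = ∑ a, ∑ b, ‖X a b‖ ^ 2 := by
    rw [← Complex.ofReal_inj, ← trace_mul_self_of_isHermitian hX]
    have : X * X = U * Matrix.diagonal (fun i => ((hX.eigenvalues i : ℂ)) ^ 2) * Uᴴ := by
      conv_lhs => rw [hs]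
      calc _ = U * Matrix.diagonal (fun i => (hX.eigenvalues i : ℂ)) * (Uᴴ * U) *
            Matrix.diagonal (fun i => (hX.eigenvalues i : ℂ)) * Uᴴ := by
              simp only [Matrix.mul_assoc]
        _ = _ := by
          rw [hUU, Matrix.mul_one, Matrix.mul_assoc U, Matrix.diagonal_mul_diagonal]
          simp only [sq]
    rw [this, Matrix.trace_mul_comm, ← Matrix.mul_assoc, hUU, Matrix.one_mul,
      Matrix.trace_diagonal]
    push_cast; rfl
  -- On each rank-one spectral projection `V` lies in `[0, 1]`. The factor `1` prepares
  -- Cauchy–Schwarz.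
  have hV : |V X| ≤ ∑ i, 1 * |hX.eigenvalues i| := by
    conv_lhs => rw [hsum, map_sum]
    refine (Finset.abs_sum_le_sum_abs _ _).trans (Finset.sum_le_sum fun i _ => ?_)
    have hp := Matrix.posSemidef_vecMulVec_self_star (U.col i)
    rw [map_smul, smul_eq_mul, abs_mul, mul_comm]
    refine mul_le_mul_of_nonneg_right ?_ (abs_nonneg _)
    rw [abs_of_nonneg (h0 _ hp)]
    exact (h1 _ hp).trans_eq (htr i)
  refine hV.trans ?_
  rw [← Real.sqrt_mul (Nat.cast_nonneg _), ← hfrob]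
  refine Real.le_sqrt_of_sq_le ((Finset.sum_mul_sq_le_sq_mul_sq _ _ _).trans_eq ?_)
  simp

/-- The squared Frobenius norm of a positive matrix is at most the square of its trace. -/
theorem sum_norm_sq_sum_mul_star_le {κ ι : Type*} [Fintype κ] [Fintype ι] (A : κ → ι → ℂ) :
    ∑ p, ∑ q, ‖∑ y, A y p * star (A y q)‖ ^ 2 ≤ (∑ p, ∑ y, ‖A y p‖ ^ 2) ^ 2 := by
  rw [sq (∑ p, _), Finset.sum_mul_sum]
  refine Finset.sum_le_sum fun p _ => Finset.sum_le_sum fun q _ => ?_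
  calc _ ≤ (∑ y, ‖A y p‖ * ‖A y q‖) ^ 2 := by
        gcongr
        refine (norm_sum_le _ _).trans_eq ?_
        simp
    _ ≤ _ := Finset.sum_mul_sq_le_sq_mul_sq _ _ _


/-! ### The action of a measurement on the memory -/

theorem partialTrace_eq_sum {ι κ : Type} [Fintype κ] (X : Matrix (ι × κ) (ι × κ) ℂ) :
    partialTrace X = ∑ x, X.submatrix (·, x) (·, x) := by
  ext i j
  simp [partialTrace, Matrix.sum_apply]

theorem partialTrace_posSemidef {ι κ : Type} [Fintype κ] {X : Matrix (ι × κ) (ι × κ) ℂ}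
    (hX : X.PosSemidef) : (partialTrace X).PosSemidef := by
  rw [partialTrace_eq_sum]
  exact Matrix.posSemidef_sum _ fun x _ => hX.submatrix _

theorem partialTrace_isHermitian {ι κ : Type} [Fintype κ] {X : Matrix (ι × κ) (ι × κ) ℂ}
    (hX : X.IsHermitian) : (partialTrace X).IsHermitian := by
  ext i j
  simp only [partialTrace, Matrix.conjTranspose_apply, Matrix.of_apply, star_sum]
  exact Finset.sum_congr rfl fun x _ => hX.apply _ _

theorem trace_partialTrace {ι κ : Type} [Fintype ι] [Fintype κ]
    (X : Matrix (ι × κ) (ι × κ) ℂ) : (partialTrace X).trace = X.trace := by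
  simp [partialTrace, Matrix.trace, Fintype.sum_prod_type]

/-- A Kraus decomposition of the map that sends the state of the fresh copy to the state of the
memory after the measurement. -/
theorem exists_kraus {α β γ : Type} [Fintype α] [Fintype β] [Fintype γ] [DecidableEq α]
    [DecidableEq γ] (M : Matrix (α × β) (α × γ) ℂ) {σ : Matrix α α ℂ} (hσ : σ.PosSemidef) :
    ∃ A : β × α → α × γ → ℂ, ∀ (X : Matrix γ γ ℂ) (a b : α),
      partialTrace (M * (σ ⊗ₖ X) * Mᴴ) a b =
        ∑ i, ∑ j, (∑ y, A y (a, i) * star (A y (b, j))) * X i j := by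
  obtain ⟨B, rfl⟩ : ∃ B : Matrix α α ℂ, σ = B * Bᴴ := by
    open scoped MatrixOrder in
    refine ⟨CFC.sqrt σ, ?_⟩
    rw [(Matrix.nonneg_iff_posSemidef.mp (CFC.sqrt_nonneg σ)).isHermitian.eq, CFC.sqrt_mul_sqrt_self σ hσ.nonneg]
  -- Absorbing a square root of `σ` into `M` leaves the identity on the memory, so the entries of
  -- `C` serve as Kraus coefficients.
  set C : Matrix (α × β) (α × γ) ℂ := M * (B ⊗ₖ (1 : Matrix γ γ ℂ)) with hC
  refine ⟨fun y p => C (p.1, y.1) (y.2, p.2), fun X a b => ?_⟩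
  have h : M * ((B * Bᴴ) ⊗ₖ X) * Mᴴ = C * ((1 : Matrix α α ℂ) ⊗ₖ X) * Cᴴ := by
    have h' : (B * Bᴴ) ⊗ₖ X = (B ⊗ₖ (1 : Matrix γ γ ℂ)) * ((1 : Matrix α α ℂ) ⊗ₖ X) *
        (B ⊗ₖ (1 : Matrix γ γ ℂ))ᴴ := by
      rw [Matrix.conjTranspose_kronecker, ← Matrix.mul_kronecker_mul, ← Matrix.mul_kronecker_mul]
      simp
    rw [h', hC, Matrix.conjTranspose_mul]
    simp only [Matrix.mul_assoc]
  rw [h]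
  have hk (x : β) : (C * ((1 : Matrix α α ℂ) ⊗ₖ X) * Cᴴ) (a, x) (b, x) =
      ∑ e, ∑ i, ∑ j, C (a, x) (e, i) * star (C (b, x) (e, j)) * X i j := by
    rw [Matrix.mul_assoc]
    simp only [Matrix.mul_apply, Matrix.kroneckerMap_apply, Fintype.sum_prod_type,
      Matrix.one_apply, Matrix.conjTranspose_apply, ite_mul, one_mul, zero_mul,
      Finset.mul_sum]
    refine Finset.sum_congr rfl fun e _ => Finset.sum_congr rfl fun i _ => ?_
    rw [Finset.sum_comm]
    refine Finset.sum_congr rfl fun j _ => ?_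
    simp only [mul_ite, mul_zero, Finset.sum_ite_eq, Finset.mem_univ, if_true]
    ring
  simp only [partialTrace, Matrix.of_apply, hk, Finset.sum_mul, Fintype.sum_prod_type]
  calc _ = ∑ x, ∑ i, ∑ j, ∑ e, C (a, x) (e, i) * star (C (b, x) (e, j)) * X i j := by
        refine Finset.sum_congr rfl fun x _ => ?_
        rw [Finset.sum_comm]
        exact Finset.sum_congr rfl fun i _ => Finset.sum_comm
    _ = _ := by
        rw [Finset.sum_comm]
        exact Finset.sum_congr rfl fun i _ => Finset.sum_comm

namespace Measurement

variable {n k : ℕ} (E : Measurement n k)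

theorem update_posSemidef {ρ : Matrix (Qubits n) (Qubits n) ℂ} (hρ : ρ.PosSemidef)
    (s : Fin E.outcomes) {σ : Matrix (Qubits k) (Qubits k) ℂ} (hσ : σ.PosSemidef) :
    (E.update ρ s σ).PosSemidef :=
  partialTrace_posSemidef ((hσ.kronecker hρ).mul_mul_conjTranspose_same _)

theorem update_isHermitian {ρ : Matrix (Qubits n) (Qubits n) ℂ} (hρ : ρ.IsHermitian)
    (s : Fin E.outcomes) {σ : Matrix (Qubits k) (Qubits k) ℂ} (hσ : σ.IsHermitian) :
    (E.update ρ s σ).IsHermitian := by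
  refine partialTrace_isHermitian (Matrix.isHermitian_mul_mul_conjTranspose _ ?_)
  rw [Matrix.IsHermitian, Matrix.conjTranspose_kronecker, hσ.eq, hρ.eq]

theorem update_add (ρ : Matrix (Qubits n) (Qubits n) ℂ) (s : Fin E.outcomes)
    (σ τ : Matrix (Qubits k) (Qubits k) ℂ) :
    E.update ρ s (σ + τ) = E.update ρ s σ + E.update ρ s τ := by
  ext i j
  simp [update, partialTrace, Matrix.add_kronecker, Matrix.mul_add, Matrix.add_mul,
    Finset.sum_add_distrib]

theorem update_smul (ρ : Matrix (Qubits n) (Qubits n) ℂ) (s : Fin E.outcomes) (c : ℝ)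
    (σ : Matrix (Qubits k) (Qubits k) ℂ) : E.update ρ s (c • σ) = c • E.update ρ s σ := by
  ext i j
  simp [update, partialTrace, Matrix.smul_kronecker, Finset.mul_sum]

theorem update_copy_add (ρ ρ' : Matrix (Qubits n) (Qubits n) ℂ) (s : Fin E.outcomes)
    (σ : Matrix (Qubits k) (Qubits k) ℂ) :
    E.update (ρ + ρ') s σ = E.update ρ s σ + E.update ρ' s σ := by
  ext i j
  simp [update, partialTrace, Matrix.kronecker_add, Matrix.mul_add, Matrix.add_mul,
    Finset.sum_add_distrib]

theorem update_copy_smul (ρ : Matrix (Qubits n) (Qubits n) ℂ) (s : Fin E.outcomes) (c : ℝ)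
    (σ : Matrix (Qubits k) (Qubits k) ℂ) : E.update (c • ρ) s σ = c • E.update ρ s σ := by
  ext i j
  simp [update, partialTrace, Matrix.kronecker_smul, Finset.mul_sum]

theorem sum_trace_update (ρ : Matrix (Qubits n) (Qubits n) ℂ)
    (σ : Matrix (Qubits k) (Qubits k) ℂ) :
    ∑ s, (E.update ρ s σ).trace = σ.trace * ρ.trace := by
  have h (s : Fin E.outcomes) :
      (E.update ρ s σ).trace = ((E.op s)ᴴ * E.op s * (σ ⊗ₖ ρ)).trace := by
    rw [update, trace_partialTrace, Matrix.trace_mul_comm, Matrix.mul_assoc]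
  simp only [h]
  rw [← Matrix.trace_sum, ← Finset.sum_mul, E.complete, Matrix.one_mul, Matrix.trace_kronecker]

theorem sum_trace_re_update {ρ : Matrix (Qubits n) (Qubits n) ℂ} (hρ : IsDensity ρ)
    (σ : Matrix (Qubits k) (Qubits k) ℂ) :
    ∑ s, (E.update ρ s σ).trace.re = σ.trace.re := by
  rw [← Complex.re_sum, E.sum_trace_update, hρ.2, mul_one]

/-- In Kraus form, each entry of the update pairs the copy with a block of one positive matrix `G`.
Parseval in `P` gives `2^n` times the squared Frobenius norm of `G`, which is at most `2^n (Tr G)²`;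
and `Tr G` is the trace of the update with copy `1`. -/
theorem sum_norm_sq_update_le (s : Fin E.outcomes) {σ : Matrix (Qubits k) (Qubits k) ℂ}
    (hσ : σ.PosSemidef) :
    ∑ P : PauliString n, ∑ a, ∑ b, ‖E.update P.matrix s σ a b‖ ^ 2 ≤
      2 ^ n * (E.update 1 s σ).trace.re ^ 2 := by
  obtain ⟨A, hA⟩ := exists_kraus (E.op s) hσ
  have htr : (E.update 1 s σ).trace.re = ∑ p, ∑ y, ‖A y p‖ ^ 2 := by
    rw [← Complex.ofReal_re (∑ p, ∑ y, ‖A y p‖ ^ 2)]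
    congr 1
    simp only [Matrix.trace, Matrix.diag_apply, update, hA, Matrix.one_apply, mul_ite, mul_one,
      mul_zero, Finset.sum_ite_eq, Finset.mem_univ, if_true, Complex.ofReal_sum,
      Fintype.sum_prod_type (α₁ := Qubits k) (α₂ := Qubits n)]
    refine Finset.sum_congr rfl fun a _ => Finset.sum_congr rfl fun i _ =>
      Finset.sum_congr rfl fun y _ => ?_
    rw [Complex.star_def, Complex.mul_conj']
    push_cast; rfl
  rw [htr]
  refine le_trans (le_of_eq ?_)
    (mul_le_mul_of_nonneg_left (sum_norm_sq_sum_mul_star_le A) (by positivity))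
  rw [Finset.sum_comm]
  calc _ = ∑ a, ∑ b, ∑ P : PauliString n, ‖E.update P.matrix s σ a b‖ ^ 2 :=
        Finset.sum_congr rfl fun a _ => Finset.sum_comm
    _ = ∑ a, ∑ b, 2 ^ n * ∑ i, ∑ j, ‖∑ y, A y (a, i) * star (A y (b, j))‖ ^ 2 := by
        refine Finset.sum_congr rfl fun a _ => Finset.sum_congr rfl fun b _ => ?_
        rw [← PauliString.sum_norm_sq]
        simp only [update, hA]
    _ = _ := by
        simp only [Fintype.sum_prod_type (α₁ := Qubits k) (α₂ := Qubits n), Finset.mul_sum]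
        exact Finset.sum_congr rfl fun a _ => Finset.sum_comm

end Measurement

/-! ### Success probabilities -/

namespace LearningTree

variable {n k : ℕ}

theorem prob_leaf (ρ : Matrix (Qubits n) (Qubits n) ℂ) (S : Set (PauliString n → ℝ))
    (f : PauliString n → ℝ) (σ : Matrix (Qubits k) (Qubits k) ℂ) :
    (leaf f : LearningTree n k 0).prob ρ S σ = S.indicator (fun _ => σ.trace.re) f := rfl

theorem prob_node {T : ℕ} (ρ : Matrix (Qubits n) (Qubits n) ℂ) (S : Set (PauliString n → ℝ))
    (E : Measurement n k) (child : Fin E.outcomes → LearningTree n k T)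
    (σ : Matrix (Qubits k) (Qubits k) ℂ) :
    (node E child).prob ρ S σ = ∑ s, (child s).prob ρ S (E.update ρ s σ) := rfl

/-- The probability of a prediction in `S`, as a linear functional of the memory state. -/
noncomputable def probLinear {T : ℕ} (t : LearningTree n k T) (ρ : Matrix (Qubits n) (Qubits n) ℂ)
    (S : Set (PauliString n → ℝ)) : Matrix (Qubits k) (Qubits k) ℂ →ₗ[ℝ] ℝ where
  toFun := t.prob ρ S
  map_add' σ τ := by
    induction t generalizing σ τ with
    | leaf f => by_cases h : f ∈ S <;> simp [prob_leaf, h]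
    | node E child ih =>
      simp only [prob_node, E.update_add, ih, Finset.sum_add_distrib]
  map_smul' c σ := by
    induction t generalizing σ with
    | leaf f => by_cases h : f ∈ S <;> simp [prob_leaf, h]
    | node E child ih =>
      simp only [RingHom.id_apply] at ih
      simp only [prob_node, E.update_smul, ih, RingHom.id_apply, smul_eq_mul, Finset.mul_sum]

theorem probLinear_apply {T : ℕ} (t : LearningTree n k T) (ρ : Matrix (Qubits n) (Qubits n) ℂ)
    (S : Set (PauliString n → ℝ)) (σ : Matrix (Qubits k) (Qubits k) ℂ) :
    t.probLinear ρ S σ = t.prob ρ S σ := rfl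

theorem prob_nonneg {T : ℕ} (t : LearningTree n k T) {ρ : Matrix (Qubits n) (Qubits n) ℂ}
    (hρ : ρ.PosSemidef) (S : Set (PauliString n → ℝ)) {σ : Matrix (Qubits k) (Qubits k) ℂ}
    (hσ : σ.PosSemidef) : 0 ≤ t.prob ρ S σ := by
  induction t generalizing σ with
  | leaf f =>
    rw [prob_leaf]
    exact Set.indicator_apply_nonneg fun _ => (Complex.le_def.mp hσ.trace_nonneg).1
  | node E child ih =>
    exact Finset.sum_nonneg fun s _ => ih s (E.update_posSemidef hρ s hσ)

/-- With `S' = ∅` this bounds a single probability; with two disjoint success events it separates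
the two states. -/
theorem prob_add_prob_le {T : ℕ} (t : LearningTree n k T) {ρ : Matrix (Qubits n) (Qubits n) ℂ}
    (hρ : IsDensity ρ) {S S' : Set (PauliString n → ℝ)} (hS : Disjoint S S')
    {σ : Matrix (Qubits k) (Qubits k) ℂ} (hσ : σ.PosSemidef) :
    t.prob ρ S σ + t.prob ρ S' σ ≤ σ.trace.re := by
  induction t generalizing σ with
  | leaf f =>
    have h0 : 0 ≤ σ.trace.re := (Complex.le_def.mp hσ.trace_nonneg).1
    rw [prob_leaf, prob_leaf]
    by_cases h : f ∈ S
    · simp [h, Set.disjoint_left.mp hS h]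
    · rw [Set.indicator_of_notMem h, zero_add]
      exact Set.indicator_le_self' (fun _ _ => h0) f
  | node E child ih =>
    rw [prob_node, prob_node, ← Finset.sum_add_distrib, ← E.sum_trace_re_update hρ σ]
    exact Finset.sum_le_sum fun s _ => ih s (E.update_posSemidef hρ.1 s hσ)

theorem prob_le_trace {T : ℕ} (t : LearningTree n k T) {ρ : Matrix (Qubits n) (Qubits n) ℂ}
    (hρ : IsDensity ρ) (S : Set (PauliString n → ℝ)) {σ : Matrix (Qubits k) (Qubits k) ℂ}
    (hσ : σ.PosSemidef) : t.prob ρ S σ ≤ σ.trace.re :=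
  (le_add_of_nonneg_right (t.prob_nonneg hρ.1 ∅ hσ)).trans
    (t.prob_add_prob_le hρ (Set.disjoint_empty S) hσ)

theorem abs_prob_le {T : ℕ} (t : LearningTree n k T) {ρ : Matrix (Qubits n) (Qubits n) ℂ}
    (hρ : IsDensity ρ) (S : Set (PauliString n → ℝ)) {X : Matrix (Qubits k) (Qubits k) ℂ}
    (hX : X.IsHermitian) : |t.prob ρ S X| ≤ √(2 ^ k) * √(∑ a, ∑ b, ‖X a b‖ ^ 2) := by
  have h := abs_le_sqrt_card_mul_frobenius (t.probLinear ρ S)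
    (fun _ h => t.prob_nonneg hρ.1 S h) (fun _ h => t.prob_le_trace hρ S h) hX
  simpa [probLinear_apply, Qubits] using h

/-- Replacing the maximally mixed copy by a copy perturbed in the direction of a random Pauli
observable has, at a single measurement outcome, little effect on average. -/
theorem sum_abs_prob_update_le {T : ℕ} (t : LearningTree n k T) (E : Measurement n k)
    (s : Fin E.outcomes) (S : Set (PauliString n → ℝ)) {σ : Matrix (Qubits k) (Qubits k) ℂ}
    (hσ : σ.PosSemidef) :
    ∑ P ∈ (Finset.univ : Finset (PauliString n)).erase fun _ => .I,
      |t.prob (((2 : ℝ) ^ n)⁻¹ • (1 + P.matrix)) S (E.update (((2 : ℝ) ^ n)⁻¹ • P.matrix) s σ)| ≤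
      2 ^ n * √(2 ^ n * 2 ^ k) * (E.update (((2 : ℝ) ^ n)⁻¹ • 1) s σ).trace.re := by
  set r : ℝ := ((2 : ℝ) ^ n)⁻¹ with hr
  set F : PauliString n → ℝ := fun P => √(∑ a, ∑ b, ‖E.update P.matrix s σ a b‖ ^ 2) with hF
  set τ : ℝ := (E.update 1 s σ).trace.re with hτ
  have hτ0 : 0 ≤ τ :=
    (Complex.le_def.mp (E.update_posSemidef Matrix.PosSemidef.one s hσ).trace_nonneg).1
  have hr0 : 0 ≤ r := by positivity
  have hτ' : (E.update (r • 1) s σ).trace.re = r * τ := by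
    rw [E.update_copy_smul, Matrix.trace_smul, Complex.smul_re, smul_eq_mul]
  have hterm (P : PauliString n) (hP : P ≠ fun _ => .I) :
      |t.prob (r • (1 + P.matrix)) S (E.update (r • P.matrix) s σ)| ≤ √(2 ^ k) * (r * F P) := by
    rw [E.update_copy_smul, ← probLinear_apply, map_smul, probLinear_apply, smul_eq_mul, abs_mul,
      abs_of_nonneg hr0, mul_left_comm]
    exact mul_le_mul_of_nonneg_left (t.abs_prob_le (PauliString.isDensity_add hP) S
      (E.update_isHermitian P.matrix_isHermitian s hσ.isHermitian)) hr0
  have hsumF : ∑ P, F P ≤ 2 ^ n * (√(2 ^ n) * τ) := by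
    have hb : (0 : ℝ) ≤ 2 ^ n * (√(2 ^ n) * τ) :=
      mul_nonneg (by positivity) (mul_nonneg (Real.sqrt_nonneg _) hτ0)
    refine (abs_le_of_sq_le_sq' ?_ hb).2
    -- Cauchy–Schwarz over the `4^n` strings, the identity string included.
    calc (∑ P, F P) ^ 2 = (∑ P, 1 * F P) ^ 2 := by simp
      _ ≤ (∑ P : PauliString n, (1 : ℝ) ^ 2) * ∑ P, F P ^ 2 := Finset.sum_mul_sq_le_sq_mul_sq _ _ _
      _ ≤ 4 ^ n * (2 ^ n * τ ^ 2) := by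
        refine mul_le_mul (le_of_eq ?_) ?_ (Finset.sum_nonneg fun _ _ => sq_nonneg _)
          (by positivity)
        · simp [Finset.card_univ, Pauli.card]
        · simp only [hF, Real.sq_sqrt (Finset.sum_nonneg fun _ _ =>
            Finset.sum_nonneg fun _ _ => sq_nonneg _)]
          exact E.sum_norm_sq_update_le s hσ
      _ = _ := by
        rw [mul_pow, mul_pow, Real.sq_sqrt (by positivity), ← pow_mul, mul_comm n 2, pow_mul]
        norm_num
  calc _ ≤ ∑ P ∈ (Finset.univ : Finset (PauliString n)).erase fun _ => .I, √(2 ^ k) * (r * F P) :=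
        Finset.sum_le_sum fun P hP => hterm P (Finset.ne_of_mem_erase hP)
    _ ≤ ∑ P, √(2 ^ k) * (r * F P) :=
        Finset.sum_le_sum_of_subset_of_nonneg (Finset.erase_subset _ _)
          fun _ _ _ => by positivity
    _ = √(2 ^ k) * (r * ∑ P, F P) := by simp only [Finset.mul_sum]
    _ ≤ √(2 ^ k) * (r * (2 ^ n * (√(2 ^ n) * τ))) := by gcongr
    _ = _ := by
        rw [hτ', Real.sqrt_mul (by positivity)]
        ring

/-- Hybrid argument: the copies before the switched one are maximally mixed, so the memory state
there is positive and independent of `P`, while the later ones are perturbed. Outcome weights under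
maximally mixed copies sum to `Tr σ`, so each round costs the same. -/
theorem sum_abs_prob_sub_prob_le {T : ℕ} (t : LearningTree n k T) (S : Set (PauliString n → ℝ))
    {σ : Matrix (Qubits k) (Qubits k) ℂ} (hσ : σ.PosSemidef) :
    ∑ P ∈ (Finset.univ : Finset (PauliString n)).erase fun _ => .I,
      |t.prob (((2 : ℝ) ^ n)⁻¹ • (1 + P.matrix)) S σ - t.prob (((2 : ℝ) ^ n)⁻¹ • 1) S σ| ≤
      T * (2 ^ n * √(2 ^ n * 2 ^ k)) * σ.trace.re := by
  induction t generalizing σ with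
  | leaf f => simp [prob_leaf]
  | @node T E child ih =>
    set r : ℝ := ((2 : ℝ) ^ n)⁻¹ with hr
    set C : ℝ := 2 ^ n * √(2 ^ n * 2 ^ k) with hC
    have hsub (P : PauliString n) :
        |(node E child).prob (r • (1 + P.matrix)) S σ - (node E child).prob (r • 1) S σ| ≤
        ∑ s, (|(child s).prob (r • (1 + P.matrix)) S (E.update (r • P.matrix) s σ)| +
          |(child s).prob (r • (1 + P.matrix)) S (E.update (r • 1) s σ) -
            (child s).prob (r • 1) S (E.update (r • 1) s σ)|) := by
      rw [prob_node, prob_node, ← Finset.sum_sub_distrib]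
      refine (Finset.abs_sum_le_sum_abs _ _).trans (Finset.sum_le_sum fun s _ => ?_)
      have h : E.update (r • (1 + P.matrix)) s σ =
          E.update (r • P.matrix) s σ + E.update (r • 1) s σ := by
        rw [← E.update_copy_add, smul_add, add_comm]
      rw [h, ← probLinear_apply, map_add, probLinear_apply, probLinear_apply, add_sub_assoc]
      exact abs_add_le _ _
    have hmm := isDensity_maximallyMixed n
    refine (Finset.sum_le_sum fun P _ => hsub P).trans ?_
    rw [Finset.sum_comm]
    calc _ ≤ ∑ s, (C * (E.update (r • 1) s σ).trace.re +
          T * C * (E.update (r • 1) s σ).trace.re) := by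
          refine Finset.sum_le_sum fun s _ => ?_
          rw [Finset.sum_add_distrib]
          exact add_le_add ((child s).sum_abs_prob_update_le E s S hσ)
            (ih s (E.update_posSemidef hmm.1 s hσ))
      _ = (T + 1) * C * ∑ s, (E.update (r • 1) s σ).trace.re := by
          rw [Finset.mul_sum]
          exact Finset.sum_congr rfl fun s _ => by ring
      _ = _ := by
          rw [E.sum_trace_re_update hmm]
          push_cast; rfl

end LearningTree

/-! ### Distinguishing the perturbed states from the maximally mixed one -/

namespace LearningAlgorithm

variable {n k T : ℕ}

/-- The predictions that are accurate for the maximally mixed state are rarely made for the state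
perturbed in the direction of a Pauli observable. -/
theorem PredictsAbsPauli.third_le_abs_sub {A : LearningAlgorithm n k T} {ε : ℝ} (hε : ε < 1 / 2)
    (hA : A.PredictsAbsPauli ε) {P : PauliString n} (hP : P ≠ fun _ => .I) :
    1 / 3 ≤ |A.prob (((2 : ℝ) ^ n)⁻¹ • (1 + P.matrix))
        {f | ∀ Q : PauliString n, |f Q - ‖(Q.matrix * (((2 : ℝ) ^ n)⁻¹ • 1)).trace‖| ≤ ε} -
      A.prob (((2 : ℝ) ^ n)⁻¹ • 1)
        {f | ∀ Q : PauliString n, |f Q - ‖(Q.matrix * (((2 : ℝ) ^ n)⁻¹ • 1)).trace‖| ≤ ε}| := by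
  have h0 := hA _ (isDensity_maximallyMixed n)
  have h1 := hA _ (PauliString.isDensity_add hP)
  have hdisj : Disjoint
      {f : PauliString n → ℝ | ∀ Q : PauliString n,
        |f Q - ‖(Q.matrix * (((2 : ℝ) ^ n)⁻¹ • 1)).trace‖| ≤ ε}
      {f | ∀ Q : PauliString n,
        |f Q - ‖(Q.matrix * (((2 : ℝ) ^ n)⁻¹ • (1 + P.matrix))).trace‖| ≤ ε} := by
    rw [Set.disjoint_left]
    intro f hf hf'
    have e := hf P
    have e' := hf' P
    rw [Matrix.mul_smul, Matrix.mul_one, Matrix.trace_smul, PauliString.trace_matrix hP, smul_zero,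
      norm_zero] at e
    have htr : (P.matrix * (((2 : ℝ) ^ n)⁻¹ • (1 + P.matrix))).trace = 1 := by
      rw [Matrix.mul_smul, mul_add, P.matrix_mul_self, Matrix.mul_one, add_comm]
      exact (PauliString.isDensity_add hP).2
    rw [htr, norm_one] at e'
    have := abs_le.mp e
    have := abs_le.mp e'
    linarith
  have h2 : _ ≤ A.init.trace.re := A.tree.prob_add_prob_le (PauliString.isDensity_add hP) hdisj
    A.isDensity_init.1
  rw [A.isDensity_init.2, Complex.one_re] at h2
  rw [le_abs]
  -- The accurate predictions for the mixed state have probability at least `2/3` there and at most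
  -- `1/3` for the perturbed state, so the difference is negative.
  right
  simp only [LearningAlgorithm.prob] at h0 h1 h2 ⊢
  linarith

/-- An algorithm that predicts all Pauli observables uses `Ω(√(2 ^ n / 2 ^ k))` copies. -/
theorem PredictsAbsPauli.quarter_le {A : LearningAlgorithm n k T} {ε : ℝ} (hn : 1 ≤ n)
    (hε : ε < 1 / 2) (hA : A.PredictsAbsPauli ε) :
    1 / 4 * 2 ^ n ≤ T * √(2 ^ n * 2 ^ k) := by
  have h := A.tree.sum_abs_prob_sub_prob_le
    {f | ∀ Q : PauliString n, |f Q - ‖(Q.matrix * (((2 : ℝ) ^ n)⁻¹ • 1)).trace‖| ≤ ε}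
    A.isDensity_init.1
  rw [A.isDensity_init.2, Complex.one_re, mul_one] at h
  have h' := (Finset.card_nsmul_le_sum _ _ _
    fun P hP => hA.third_le_abs_sub hε (Finset.ne_of_mem_erase hP)).trans h
  rw [Finset.card_erase_of_mem (Finset.mem_univ _), Finset.card_univ, PauliString.card,
    nsmul_eq_mul, Nat.cast_sub (Nat.one_le_pow _ _ (by norm_num))] at h'
  push_cast at h'
  -- The constant `1/4` arises from `(4^n - 1)/3 ≥ 4^n/4`, which needs `n ≥ 1`.
  have h4 : (4 : ℝ) ≤ 4 ^ n := le_self_pow₀ (by norm_num) (by omega)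
  have h5 : (4 : ℝ) ^ n = 2 ^ n * 2 ^ n := by rw [← mul_pow]; norm_num
  have h6 : (0 : ℝ) < 2 ^ n := by positivity
  refine le_of_mul_le_mul_left ?_ h6
  nlinarith

end LearningAlgorithm

end PauliMemory

theorem mainTheorem5 :
    ∃ c : ℝ, 0 < c ∧
      ∀ (n k T : ℕ), 1 ≤ n →
        ∀ (ε : ℝ), ε < 1 / 2 →
          ∀ A : PauliMemory.LearningAlgorithm n k T, A.PredictsAbsPauli ε →
            c * (2 : ℝ) ^ (((n : ℝ) - (k : ℝ)) / 3) ≤ (T : ℝ) := by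
  refine ⟨1 / 4, by norm_num, fun n k T hn ε hε A hA => ?_⟩
  have h := hA.quarter_le hn hε
  have hsqrt : √((2 : ℝ) ^ n * 2 ^ k) = 2 ^ (((n : ℝ) + k) / 2) := by
    rw [← Real.rpow_natCast, ← Real.rpow_natCast, ← Real.rpow_add two_pos, Real.sqrt_eq_rpow,
      ← Real.rpow_mul two_pos.le, mul_one_div]
  have hbound : 1 / 4 * (2 : ℝ) ^ (((n : ℝ) - k) / 2) ≤ T := by
    refine le_of_mul_le_mul_right ?_ (Real.rpow_pos_of_pos two_pos (((n : ℝ) + k) / 2))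
    rw [mul_assoc, ← Real.rpow_add two_pos, ← hsqrt]
    refine (le_of_eq ?_).trans h
    rw [← Real.rpow_natCast]
    ring_nf
  -- For `k ≤ n` the exponent `(n-k)/2` dominates `(n-k)/3`. For `k ≥ n` the claimed bound is at
  -- most `1/4`, so `T ≥ 1` suffices, and `T = 0` contradicts `hbound`.
  rcases le_total k n with hk | hk
  · refine le_trans ?_ hbound
    have hk' : (k : ℝ) ≤ n := Nat.cast_le.mpr hk
    gcongr
    · norm_num
    · linarith
  · have hk' : (n : ℝ) ≤ k := Nat.cast_le.mpr hk
    have hT : (1 : ℝ) ≤ T := by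
      rw [Nat.one_le_cast, Nat.one_le_iff_ne_zero]
      rintro rfl
      have := Real.rpow_pos_of_pos two_pos (((n : ℝ) - k) / 2)
      rw [Nat.cast_zero] at hbound
      linarith
    have := Real.rpow_le_one_of_one_le_of_nonpos (x := 2) (by norm_num)
      (show ((n : ℝ) - k) / 3 ≤ 0 by linarith)
    linarith
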